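/- Let $m_{12},m_{23}\ge 2$ be integers such that the product $m_{12}m_{23}$ is divisible neither by $2$ nor by $3$, and let $$W=\langle s_1,s_2,s_3 \mid s_1^2=s_2^2=s_3^2=1,\ (s_1s_2)^{m_{12}}=(s_2s_3)^{m_{23}}=1\rangle$$ be the Coxeter group of rank $3$ with exponents $m_{12}$, $m_{23}$ and $m_{13}=\infty$ (i.e. there is no relation on $s_1s_3$). A reflection of $W$ is an element conjugate in $W$ to one of $s_1,s_2,s_3$, and a reflection subgroup of $W$ is a proper subgroup (of index greater than one) generated by reflections. Then $W$ has no reflection subgroup of finite index. -/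

import Mathlib

/-- A subgroup `V` of the Coxeter group `W` is a *reflection subgroup* if it is proper (that is, of
index greater than one) and generated by a set of reflections of the Coxeter system `cs`, where a
reflection is a conjugate in `W` of a simple reflection. -/
def CoxeterSystem.IsReflectionSubgroup {B : Type*} {M : CoxeterMatrix B} {W : Type*} [Group W]
    (cs : CoxeterSystem M W) (V : Subgroup W) : Prop :=
  V ≠ ⊤ ∧ ∃ T : Set W, (∀ t ∈ T, cs.IsReflection t) ∧ V = Subgroup.closure T

/-! Let `W` act on a finite `X = W ⧸ V`. As `V` is generated by reflections, a cocycle on `X`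
vanishing at fixed points has no monodromy, so it is a coboundary (`exists_coboundary`). Two choices
of cocycle constrain `X`. Since `m₁₃ = ∞`, the graph whose `E` edges are the `s₂`-orbits and whose
`P + R` vertices are the orbits of `⟨s₁, s₂⟩` and `⟨s₂, s₃⟩` satisfies `E + 1 ≤ P + R`
(`card_quot_add_one_le`). Also `s₂` never agrees with `s₁` or `s₃` at a moved point; with both
exponents coprime to 12, a dihedral orbit without a common fixed point then has at least four points
moved by `s₂` (`four_mul_card_quot_le`). If `s₂` fixes `F` of the `n` points, then `4E ≥ 2n + 2F`,
while `4(P + R) ≤ 4F + 2(n - F)`, as no point is fixed by all three generators. Hence `P + R ≤ E`, a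
contradiction. -/

open MulAction

namespace CoxeterSystem

/-! ### Cocycles on the coset space -/

section Cocycle

variable {B W A : Type*} {M : CoxeterMatrix B} [Group W] [AddCommGroup A]
  (cs : CoxeterSystem M W) {V : Subgroup W}

/-- If `V` is generated by reflections, then every `A`-valued cocycle on `W ⧸ V` that vanishes
where a simple reflection fixes a point is a coboundary. -/
theorem exists_coboundary {T : Set W} (hT : ∀ t ∈ T, cs.IsReflection t)
    (hV : V = Subgroup.closure T) (c : B → W ⧸ V → A)
    (ρ : W →* Equiv.Perm ((W ⧸ V) × A))
    (hρ : ∀ i x a, ρ (cs.simple i) (x, a) = (cs.simple i • x, a + c i x))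
    (hc : ∀ i x, cs.simple i • x = x → c i x = 0) :
    ∃ f : W ⧸ V → A, ∀ i x, f (cs.simple i • x) = f x + c i x := by
  have hfst : ∀ w p, (ρ w p).1 = w • p.1 := by
    intro w
    induction w using cs.simple_induction with
    | simple i => rintro ⟨x, a⟩; rw [hρ]
    | one => simp
    | mul w w' h h' => intro p; rw [map_mul, Equiv.Perm.mul_apply, h, h', mul_smul]
  let p₀ : (W ⧸ V) × A := (((1 : W) : W ⧸ V), 0)
  have hfix : ∀ v ∈ V, ρ v p₀ = p₀ := by
    intro v hv
    suffices h : V ≤ (stabilizer (Equiv.Perm ((W ⧸ V) × A)) p₀).comap ρ from h hv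
    conv_lhs => rw [hV]
    rw [Subgroup.closure_le]
    intro t ht
    obtain ⟨w, i, rfl⟩ := hT t ht
    have hmem : w * cs.simple i * w⁻¹ ∈ V := hV ▸ Subgroup.subset_closure ht
    -- A conjugate `w s w⁻¹` lies in `V` exactly when `s` fixes the coset `w⁻¹V`; there the cocycle
    -- vanishes, so the lifted reflection fixes `p₀`.
    have hx : cs.simple i • (w⁻¹ • (((1 : W) : W ⧸ V))) = w⁻¹ • (((1 : W) : W ⧸ V)) := by
      simp only [MulAction.Quotient.smul_coe, smul_eq_mul, mul_one]
      rw [QuotientGroup.eq]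
      convert V.inv_mem hmem using 1
      group
    have hy : ρ (cs.simple i) (ρ w⁻¹ p₀) = ρ w⁻¹ p₀ := by
      have h1 : (ρ w⁻¹ p₀).1 = w⁻¹ • (((1 : W) : W ⧸ V)) := hfst _ _
      rcases h : ρ w⁻¹ p₀ with ⟨x, a⟩
      rw [h] at h1
      simp only at h1
      subst h1
      rw [hρ, hc i _ hx, hx, add_zero]
    show ρ (w * cs.simple i * w⁻¹) p₀ = p₀
    rw [map_mul, map_mul, Equiv.Perm.mul_apply, Equiv.Perm.mul_apply, hy,
      ← Equiv.Perm.mul_apply, ← map_mul]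
    simp
  have hout : ∀ w : W, ρ ((w : W ⧸ V)).out p₀ = ρ w p₀ := by
    intro w
    obtain ⟨h, hh⟩ := QuotientGroup.mk_out_eq_mul V w
    rw [hh, map_mul, Equiv.Perm.mul_apply, hfix _ h.2]
  -- The orbit of `p₀` is the graph of a function on `W ⧸ V`, which serves as the potential.
  refine ⟨fun x => (ρ x.out p₀).2, fun i x => ?_⟩
  induction x using QuotientGroup.induction_on with
  | H w =>
    simp only
    rw [MulAction.Quotient.smul_coe, hout, hout, smul_eq_mul, map_mul, Equiv.Perm.mul_apply]
    have h1 : (ρ w p₀).1 = (w : W ⧸ V) := by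
      rw [hfst]; simp [p₀]
    rcases h : ρ w p₀ with ⟨x, a⟩
    rw [h] at h1
    simp only at h1
    subst h1
    rw [hρ]

end Cocycle

/-! ### Twisted lifts of the action -/

section Action

variable {B W X A : Type*} {M : CoxeterMatrix B} [Group W] [MulAction W X] [AddCommGroup A]
  (cs : CoxeterSystem M W)

theorem simple_smul_simple_smul (i : B) (x : X) : cs.simple i • cs.simple i • x = x := by
  rw [smul_smul, simple_mul_simple_self, one_smul]

/-- The permutation of `X × A` that lifts the action of a simple reflection on `X`, twisted by a
function that is odd under this reflection. -/
def twist (i : B) (c : X → A) (hc : ∀ x, c (cs.simple i • x) = -c x) :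
    Equiv.Perm (X × A) :=
  Function.Involutive.toPerm (fun p => (cs.simple i • p.1, p.2 + c p.1)) fun p => by
    simp [cs.simple_smul_simple_smul, hc]

theorem twist_apply (i : B) (c : X → A) (hc : ∀ x, c (cs.simple i • x) = -c x) (x : X) (a : A) :
    cs.twist i c hc (x, a) = (cs.simple i • x, a + c x) := rfl

theorem twist_mul_self (i : B) (c : X → A) (hc : ∀ x, c (cs.simple i • x) = -c x) :
    cs.twist i c hc * cs.twist i c hc = 1 := by
  ext1 p
  exact Function.Involutive.toPerm_involutive _ p

theorem twist_mul_pow_swap {i j : B} {c d : X → A} (hc : ∀ x, c (cs.simple i • x) = -c x)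
    (hd : ∀ x, d (cs.simple j • x) = -d x) {m : ℕ}
    (h : (cs.twist i c hc * cs.twist j d hd) ^ m = 1) :
    (cs.twist j d hd * cs.twist i c hc) ^ m = 1 := by
  have : cs.twist j d hd * cs.twist i c hc = (cs.twist i c hc * cs.twist j d hd)⁻¹ := by
    rw [mul_inv_rev, eq_comm, inv_eq_of_mul_eq_one_left (cs.twist_mul_self j d hd),
      inv_eq_of_mul_eq_one_left (cs.twist_mul_self i c hc)]
  rw [this, inv_pow, h, inv_one]

/-- Twisting two simple reflections by the coboundary of one function gives a pair of permutations
that still satisfies the braid relation. -/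
theorem twist_coboundary_mul_pow {i j : B} (g : X → A) {c d : X → A}
    (hc : ∀ x, c (cs.simple i • x) = -c x) (hd : ∀ x, d (cs.simple j • x) = -d x)
    (hcg : ∀ x, c x = g (cs.simple i • x) - g x) (hdg : ∀ x, d x = g (cs.simple j • x) - g x) :
    (cs.twist i c hc * cs.twist j d hd) ^ M i j = 1 := by
  have key : ∀ n x a, ((cs.twist i c hc * cs.twist j d hd) ^ n) (x, a) =
      ((cs.simple i * cs.simple j) ^ n • x,
        a + (g ((cs.simple i * cs.simple j) ^ n • x) - g x)) := by
    intro n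
    induction n with
    | zero => simp
    | succ n ih =>
      intro x a
      rw [pow_succ', Equiv.Perm.mul_apply, ih, Equiv.Perm.mul_apply, twist_apply, twist_apply,
        pow_succ', mul_smul, mul_smul, hcg, hdg]
      have telescope : ∀ α β γ δ : A, a + (β - α) + (γ - β) + (δ - γ) = a + (δ - α) := by
        intros
        abel
      exact Prod.ext rfl (telescope _ _ _ _)
  ext1 ⟨x, a⟩
  rw [key, simple_mul_simple_pow]
  simp

end Action

/-! ### Double edges at a leaf of the Coxeter diagram -/

section Leaf

variable {B W : Type*} {M : CoxeterMatrix B} [Group W] (cs : CoxeterSystem M W) {V : Subgroup W}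

/-- Suppose that `j` is the only neighbour of `i`. If `V` is generated by reflections, then the
simple reflections `i` and `j` never agree at a point of `W ⧸ V` that they move. -/
theorem simple_smul_eq_self_of_simple_smul_eq {T : Set W} (hT : ∀ t ∈ T, cs.IsReflection t)
    (hV : V = Subgroup.closure T) {i j : B} (hij : i ≠ j) (hi : ∀ k, k ≠ i → k ≠ j → M i k = 0)
    (y : W ⧸ V) (hy : cs.simple i • y = cs.simple j • y) : cs.simple i • y = y := by
  classical
  by_contra hne
  set z := cs.simple i • y with hz
  have hiz : cs.simple i • z = y := by rw [hz, cs.simple_smul_simple_smul]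
  have hjz : cs.simple j • z = y := by rw [hy, cs.simple_smul_simple_smul]
  -- Unit flow along the `i`-edge from `y` to `z`. Going round the double edge adds `1` each time,
  -- so the braid relation needs coefficients modulo `M i j`.
  let c : B → W ⧸ V → ZMod (M i j) := fun k x =>
    if k = i then (if x = y then 1 else if x = z then -1 else 0) else 0
  have hy_iff : ∀ x, cs.simple i • x = y ↔ x = z := fun x =>
    ⟨fun h => by rw [hz, ← h, cs.simple_smul_simple_smul], fun h => by rw [h, hiz]⟩
  have hz_iff : ∀ x, cs.simple i • x = z ↔ x = y := fun x =>
    ⟨fun h => by rw [← hiz, ← h, cs.simple_smul_simple_smul], fun h => by rw [h]⟩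
  have hy_iff' : ∀ x, cs.simple j • x = y ↔ x = z := fun x =>
    ⟨fun h => by rw [hy, ← h, cs.simple_smul_simple_smul], fun h => by rw [h, hjz]⟩
  have hz_iff' : ∀ x, cs.simple j • x = z ↔ x = y := fun x =>
    ⟨fun h => by rw [← hjz, ← h, cs.simple_smul_simple_smul], fun h => by rw [h, ← hy]⟩
  have hodd : ∀ k x, c k (cs.simple k • x) = -c k x := by
    intro k x
    by_cases hk : k = i
    · subst hk
      simp only [c, if_true, hy_iff, hz_iff]
      by_cases h1 : x = y
      · simp [h1, Ne.symm hne]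
      · by_cases h2 : x = z
        · simp [h2, hne]
        · simp [h1, h2]
    · simp [c, hk]
  have hcj : ∀ x, c j x = 0 := fun x => by simp [c, hij.symm]
  have hij_pow : (cs.twist i (c i) (hodd i) * cs.twist j (c j) (hodd j)) ^ M i j = 1 := by
    have hinv : ∀ x, c i (cs.simple j • cs.simple i • cs.simple j • x) = c i (cs.simple j • x) := by
      intro x
      simp only [c, if_true, hy_iff', hz_iff', hy_iff, hz_iff]
    have key : ∀ n : ℕ, ∀ x a,
        ((cs.twist i (c i) (hodd i) * cs.twist j (c j) (hodd j)) ^ n) (x, a) =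
        ((cs.simple i * cs.simple j) ^ n • x, a + n * c i (cs.simple j • x)) := by
      intro n
      induction n with
      | zero => simp
      | succ n ih =>
        intro x a
        rw [pow_succ, Equiv.Perm.mul_apply, Equiv.Perm.mul_apply, twist_apply, twist_apply, ih,
          pow_succ, mul_smul, mul_smul, hinv, hcj]
        congr 1
        push_cast
        ring
    ext1 ⟨x, a⟩
    rw [key, simple_mul_simple_pow]
    simp
  have hlift : M.IsLiftable fun k => cs.twist k (c k) (hodd k) := by
    intro k l
    by_cases hk : k = i
    · subst hk
      by_cases hl : l = k
      · subst hl
        rw [M.diagonal, pow_one, twist_mul_self]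
      · by_cases hl' : l = j
        · subst hl'
          exact hij_pow
        · rw [hi l hl hl', pow_zero]
    · by_cases hl : l = i
      · subst hl
        by_cases hk' : k = j
        · subst hk'
          have hkl : M k l = M l k := M.symmetric k l
          simp only [hkl]
          exact cs.twist_mul_pow_swap _ _ hij_pow
        · rw [(M.symmetric k l).trans (hi k hk hk'), pow_zero]
      · exact cs.twist_coboundary_mul_pow 0 _ _ (by simp [c, hk]) (by simp [c, hl])
  obtain ⟨f, hf⟩ := cs.exists_coboundary hT hV c (cs.lift ⟨_, hlift⟩)
    (fun k x a => by rw [lift_apply_simple, twist_apply]) (by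
      intro k x hx
      by_cases hk : k = i
      · subst hk
        have h1 : x ≠ y := by rintro rfl; exact hne hx
        have h2 : x ≠ z := by rintro rfl; exact hne (hx.symm.trans hiz)
        simp [c, h1, h2]
      · simp [c, hk])
  have h1 := hf i y
  have h2 := hf j y
  rw [← hy, hcj, add_zero] at h2
  rw [← hz, h2] at h1
  have h3 : (1 : ZMod (M i j)) = 0 := by simpa [c] using h1
  have := M.off_diagonal i j hij
  rw [← Nat.cast_one, ZMod.natCast_eq_zero_iff, Nat.dvd_one] at h3
  exact this h3

end Leaf

/-! ### Counting orbits -/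

section Counting

variable {B W X : Type*} {M : CoxeterMatrix B} [Group W] [MulAction W X] (cs : CoxeterSystem M W)

/-- Two points are related if a simple reflection from `J` takes the first to the second. -/
def Step (X : Type*) [MulAction W X] (J : Set B) (x y : X) : Prop :=
  ∃ i ∈ J, y = cs.simple i • x

theorem quot_mk_simple_smul {J : Set B} {i : B} (hi : i ∈ J) (x : X) :
    Quot.mk (cs.Step X J) (cs.simple i • x) = Quot.mk (cs.Step X J) x :=
  (Quot.sound ⟨i, hi, rfl⟩).symm

theorem eq_or_eq_of_quot_mk_eq {i : B} {x y : X}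
    (h : Quot.mk (cs.Step X {i}) x = Quot.mk (cs.Step X {i}) y) :
    x = y ∨ x = cs.simple i • y := by
  let φ : Quot (cs.Step X {i}) → Sym2 X := Quot.lift (fun x => s(x, cs.simple i • x)) (by
    rintro x _ ⟨_, rfl, rfl⟩
    simp only [cs.simple_smul_simple_smul]
    exact Sym2.eq_swap)
  have h' : s(x, cs.simple i • x) = s(y, cs.simple i • y) := congrArg φ h
  rw [Sym2.eq_iff] at h'
  tauto

variable [Fintype X] [DecidableEq X]

open Finset

/-- An orbit is either one fixed point, counted twice on the left, or two moved points. -/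
theorem card_add_card_fixed_le (i : B) :
    Fintype.card X + #{x : X | cs.simple i • x = x} ≤ 2 * Nat.card (Quot (cs.Step X {i})) := by
  classical
  have := Fintype.ofFinite (Quot (cs.Step X {i}))
  rw [Nat.card_eq_fintype_card, ← card_univ, ← card_univ,
    card_eq_sum_card_fiberwise (s := (univ : Finset X)) (t := univ)
      (f := Quot.mk (cs.Step X {i})) (by simp),
    card_eq_sum_card_fiberwise (s := ({x | cs.simple i • x = x} : Finset X)) (t := univ)
      (f := Quot.mk (cs.Step X {i})) (by simp), ← sum_add_distrib, mul_comm, ← smul_eq_mul]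
  refine sum_le_card_nsmul _ _ _ fun q _ => ?_
  obtain ⟨x, rfl⟩ := Quot.exists_rep q
  by_cases hx : cs.simple i • x = x
  · have h1 : ∀ y, Quot.mk (cs.Step X {i}) y = Quot.mk (cs.Step X {i}) x → y = x := fun y hy => by
      rcases cs.eq_or_eq_of_quot_mk_eq hy with h | h
      · exact h
      · exact h.trans hx
    have h2 : ∀ s : Finset X, #{y ∈ s | Quot.mk (cs.Step X {i}) y = Quot.mk (cs.Step X {i}) x} ≤ 1 :=
      fun s => (card_le_card (t := {x}) fun y hy => by
        simpa using h1 y (mem_filter.1 hy).2).trans (by simp)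
    exact add_le_add (h2 _) (h2 _)
  · have h1 : #{y ∈ (univ : Finset X) | Quot.mk (cs.Step X {i}) y = Quot.mk (cs.Step X {i}) x} ≤ 2 :=
      (card_le_card (t := {x, cs.simple i • x}) fun y hy => by
        simpa using cs.eq_or_eq_of_quot_mk_eq (mem_filter.1 hy).2).trans card_le_two
    have h2 : #{y ∈ ({y | cs.simple i • y = y} : Finset X) |
        Quot.mk (cs.Step X {i}) y = Quot.mk (cs.Step X {i}) x} = 0 := by
      rw [card_eq_zero, eq_empty_iff_forall_notMem]
      intro y hy
      simp only [mem_filter, mem_univ, true_and] at hy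
      rcases cs.eq_or_eq_of_quot_mk_eq hy.2 with rfl | rfl
      · exact hx hy.1
      · rw [cs.simple_smul_simple_smul] at hy
        exact hx hy.1.symm
    omega

/-- Let `M i j` be coprime to `12`, and suppose that the simple reflections `i` and `j` never agree at a
point that they move. Then each orbit of the dihedral group that they generate consists of one
fixed point or contains four points moved by `j`. -/
theorem four_mul_card_quot_le {i j : B} (h6 : (M i j).Coprime 12)
    (hleaf : ∀ x : X, cs.simple i • x = cs.simple j • x → cs.simple i • x = x) :
    4 * Nat.card (Quot (cs.Step X {i, j})) ≤
      4 * #{x : X | cs.simple i • x = x ∧ cs.simple j • x = x} +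
        #{x : X | cs.simple j • x ≠ x} := by
  classical
  have := Fintype.ofFinite (Quot (cs.Step X {i, j}))
  set π : X → Quot (cs.Step X {i, j}) := Quot.mk _ with hπ
  rw [Nat.card_eq_fintype_card, ← card_univ,
    card_eq_sum_card_fiberwise (s := ({x | cs.simple i • x = x ∧ cs.simple j • x = x} : Finset X))
      (t := univ) (f := π) (by simp),
    card_eq_sum_card_fiberwise (s := ({x | cs.simple j • x ≠ x} : Finset X)) (t := univ)
      (f := π) (by simp), mul_sum, ← sum_add_distrib, mul_comm, ← smul_eq_mul]
  refine card_nsmul_le_sum _ _ _ fun q _ => ?_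
  have hmi : ∀ x, π (cs.simple i • x) = π x := fun x => cs.quot_mk_simple_smul (by simp) x
  have hmj : ∀ x, π (cs.simple j • x) = π x := fun x => cs.quot_mk_simple_smul (by simp) x
  have hcyc : ∀ x : X, (cs.simple i * cs.simple j) ^ 12 • x = x →
      cs.simple i • x = x ∧ cs.simple j • x = x := by
    intro x hx
    have h1 : cs.simple i * cs.simple j ∈ stabilizer W x := by
      -- Bézout: the stabilizer contains the powers with coprime exponents `M i j` and `12`, hence
      -- the rotation itself.
      have hm : (cs.simple i * cs.simple j) ^ M i j ∈ stabilizer W x := by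
        rw [simple_mul_simple_pow]; exact one_mem _
      have := (stabilizer W x).mul_mem
        (zpow_mem hm ((M i j).gcdA 12))
        (zpow_mem (show (cs.simple i * cs.simple j) ^ 12 ∈ stabilizer W x from hx)
          ((M i j).gcdB 12))
      rw [← zpow_natCast, ← zpow_natCast, ← zpow_mul, ← zpow_mul, ← zpow_add,
        ← Nat.gcd_eq_gcd_ab, h6] at this
      simpa using this
    rw [mem_stabilizer_iff, mul_smul] at h1
    have h2 : cs.simple i • x = cs.simple j • x := by
      conv_lhs => rw [← h1]
      rw [cs.simple_smul_simple_smul]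
    exact ⟨hleaf x h2, h2 ▸ hleaf x h2⟩
  by_cases hfix : ∃ x, π x = q ∧ cs.simple i • x = x ∧ cs.simple j • x = x
  · obtain ⟨x, hx, hx'⟩ := hfix
    have : 0 < #{y ∈ ({x | cs.simple i • x = x ∧ cs.simple j • x = x} : Finset X) | π y = q} :=
      card_pos.2 ⟨x, by simp [hx, hx']⟩
    omega
  have hcyc' : ∀ x, π x = q → (cs.simple i * cs.simple j) ^ 12 • x ≠ x := fun x hx h =>
    hfix ⟨x, hx, hcyc x h⟩
  obtain ⟨y, hyq, hy⟩ : ∃ y, π y = q ∧ cs.simple j • y ≠ y := by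
    by_contra! hall
    obtain ⟨x, rfl⟩ := Quot.exists_rep q
    have h1 := hall x rfl
    have h2 := hall (cs.simple i • x) (hmi x)
    refine hcyc' x rfl ?_
    simp [pow_succ, mul_smul, h1, h2, cs.simple_smul_simple_smul]
  suffices h : ∃ w, π w = q ∧ cs.simple j • w ≠ w ∧ w ≠ y ∧ w ≠ cs.simple j • y by
    obtain ⟨w, hwq, hw, hwy, hwz⟩ := h
    have hsub : ({y, cs.simple j • y, w, cs.simple j • w} : Finset X) ⊆
        {x ∈ ({x | cs.simple j • x ≠ x} : Finset X) | π x = q} := by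
      intro x hx
      simp only [mem_insert, mem_singleton] at hx
      rcases hx with rfl | rfl | rfl | rfl <;>
        simp [hmj, hyq, hwq, hy, hw, cs.simple_smul_simple_smul, Ne.symm]
    have hcard : #({y, cs.simple j • y, w, cs.simple j • w} : Finset X) = 4 := by
      have e1 : y ≠ cs.simple j • w := fun h => hwz (by rw [h, cs.simple_smul_simple_smul])
      have e2 : cs.simple j • y ≠ cs.simple j • w := fun h => hwy ((smul_left_cancel _ h).symm)
      rw [card_insert_of_notMem, card_insert_of_notMem, card_insert_of_notMem, card_singleton]
      · simpa using Ne.symm hw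
      · simpa using ⟨Ne.symm hwz, fun h => e2 (congrArg _ h)⟩
      · simpa using ⟨Ne.symm hy, Ne.symm hwy, e1⟩
    have := card_le_card hsub
    omega
  -- Otherwise `{y, z}` is the only `j`-edge of the orbit, which is then a double edge or a path on
  -- 2, 3 or 4 points; the rotation has order 1, 2, 3 or 4 there, all dividing 12.
  by_contra! hno
  set z := cs.simple j • y with hz
  have hjz : cs.simple j • z = y := by rw [hz, cs.simple_smul_simple_smul]
  have hzq : π z = q := by rw [hz, hmj, hyq]
  have hother : ∀ w, π w = q → w ≠ y → w ≠ z → cs.simple j • w = w := fun w hw hwy hwz => by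
    by_contra h
    exact hwz (hno w hw h hwy)
  refine hcyc' y hyq ?_
  by_cases hy1 : cs.simple i • y = z
  · have hz1 : cs.simple i • z = y := by rw [← hy1, cs.simple_smul_simple_smul]
    simp [pow_succ, mul_smul, ← hz, hz1]
  have hz1 : cs.simple i • z ≠ y := fun h => hy1 (by rw [← h, cs.simple_smul_simple_smul])
  have hyy : cs.simple i • y ≠ y → cs.simple j • cs.simple i • y = cs.simple i • y := fun h =>
    hother _ (by rw [hmi, hyq]) h hy1
  have hzz : cs.simple i • z ≠ z → cs.simple j • cs.simple i • z = cs.simple i • z := fun h =>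
    hother _ (by rw [hmi, hzq]) hz1 h
  by_cases hy2 : cs.simple i • y = y <;> by_cases hz2 : cs.simple i • z = z
  · simp [pow_succ, mul_smul, ← hz, hjz, hy2, hz2]
  · simp [pow_succ, mul_smul, ← hz, hjz, hy2, hzz hz2, cs.simple_smul_simple_smul]
  · simp [pow_succ, mul_smul, ← hz, hjz, hz2, hyy hy2, cs.simple_smul_simple_smul]
  · simp [pow_succ, mul_smul, ← hz, hjz, hyy hy2, hzz hz2, cs.simple_smul_simple_smul]

end Counting

/-! ### The orbit graph in rank three -/

section RankThree

variable {W : Type*} [Group W] {M : CoxeterMatrix (Fin 3)} (cs : CoxeterSystem M W)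
  {V : Subgroup W}

/-- The graph of orbits of the two dihedral parabolic subgroups on `W ⧸ V`, with the orbits of the
middle simple reflection as edges, is acyclic. -/
theorem exists_split {A : Type*} [AddCommGroup A] (h13 : M 0 2 = 0) {T : Set W}
    (hT : ∀ t ∈ T, cs.IsReflection t) (hV : V = Subgroup.closure T) (g : W ⧸ V → A)
    (hg : ∀ x, g (cs.simple 1 • x) = g x) :
    ∃ f : W ⧸ V → A, (∀ x, f (cs.simple 0 • x) = f x) ∧ (∀ x, f (cs.simple 1 • x) = f x) ∧
      ∀ x, f (cs.simple 2 • x) - g (cs.simple 2 • x) = f x - g x := by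
  -- On letters `0, 1` this is the coboundary of `0`, on `1, 2` that of `g`; the pair `0, 2` has no
  -- relation to check.
  let c : Fin 3 → W ⧸ V → A := fun k x => if k = 2 then g (cs.simple 2 • x) - g x else 0
  have hodd : ∀ k x, c k (cs.simple k • x) = -c k x := by
    intro k x
    by_cases hk : k = 2
    · subst hk
      simp [c, cs.simple_smul_simple_smul]
    · simp [c, hk]
  have h12 : ∀ k l : Fin 3, k ≠ 0 → l ≠ 0 →
      (cs.twist k (c k) (hodd k) * cs.twist l (c l) (hodd l)) ^ M k l = 1 := by
    have : ∀ k : Fin 3, k ≠ 0 → ∀ x, c k x = g (cs.simple k • x) - g x := by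
      intro k hk x
      fin_cases k
      · exact absurd rfl hk
      · simp [c, hg]
      · simp [c]
    exact fun k l hk hl => cs.twist_coboundary_mul_pow g _ _ (this k hk) (this l hl)
  have h01 : ∀ k l : Fin 3, k ≠ 2 → l ≠ 2 →
      (cs.twist k (c k) (hodd k) * cs.twist l (c l) (hodd l)) ^ M k l = 1 := fun k l hk hl =>
    cs.twist_coboundary_mul_pow 0 _ _ (by simp [c, hk]) (by simp [c, hl])
  have hlift : M.IsLiftable fun k => cs.twist k (c k) (hodd k) := by
    have h31 : M 2 0 = 0 := by rw [M.symmetric, h13]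
    intro k l
    by_cases hk : k = 0
    · by_cases hl : l = 2
      · subst hk hl
        rw [h13, pow_zero]
      · exact h01 k l (by simp [hk]) hl
    · by_cases hl : l = 0
      · by_cases hk2 : k = 2
        · subst hk2 hl
          rw [h31, pow_zero]
        · exact h01 k l hk2 (by simp [hl])
      · exact h12 k l hk hl
  obtain ⟨f, hf⟩ := cs.exists_coboundary hT hV c (cs.lift ⟨_, hlift⟩)
    (fun k x a => by rw [lift_apply_simple, twist_apply]) (by
      intro k x hx
      by_cases hk : k = 2
      · subst hk
        simp [c, hx]
      · simp [c, hk])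
  refine ⟨f, fun x => ?_, fun x => ?_, fun x => ?_⟩
  · rw [hf]; simp [c]
  · rw [hf]; simp [c]
  · rw [hf]
    simp only [c, if_true]
    abel

/-- Rank–nullity for the map from vertex functions to edge functions: `exists_split` makes it onto,
and `(1, -1)` lies in its kernel. -/
theorem card_quot_add_one_le [Finite (W ⧸ V)] (h13 : M 0 2 = 0) {T : Set W}
    (hT : ∀ t ∈ T, cs.IsReflection t) (hV : V = Subgroup.closure T) :
    Nat.card (Quot (cs.Step (W ⧸ V) {1})) + 1 ≤
      Nat.card (Quot (cs.Step (W ⧸ V) {0, 1})) + Nat.card (Quot (cs.Step (W ⧸ V) {2, 1})) := by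
  classical
  let Q := Quot (cs.Step (W ⧸ V) {1})
  let P := Quot (cs.Step (W ⧸ V) {0, 1})
  let R := Quot (cs.Step (W ⧸ V) {2, 1})
  have := Fintype.ofFinite Q
  have := Fintype.ofFinite P
  have := Fintype.ofFinite R
  have toP : ∀ x y, cs.Step (W ⧸ V) {1} x y → Quot.mk (cs.Step (W ⧸ V) {0, 1}) x = Quot.mk _ y := by
    rintro x _ ⟨_, rfl, rfl⟩
    exact (cs.quot_mk_simple_smul (by simp) x).symm
  have toR : ∀ x y, cs.Step (W ⧸ V) {1} x y → Quot.mk (cs.Step (W ⧸ V) {2, 1}) x = Quot.mk _ y := by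
    rintro x _ ⟨_, rfl, rfl⟩
    exact (cs.quot_mk_simple_smul (by simp) x).symm
  let a : Q → P := Quot.lift _ toP
  let b : Q → R := Quot.lift _ toR
  let L : ((P → ℚ) × (R → ℚ)) →ₗ[ℚ] (Q → ℚ) :=
    (LinearMap.funLeft ℚ ℚ a).coprod (LinearMap.funLeft ℚ ℚ b)
  have hL : ∀ u v x, L (u, v) (Quot.mk _ x) = u (Quot.mk _ x) + v (Quot.mk _ x) := fun u v x => by
    simp [L, LinearMap.funLeft_apply, a, b]
  have hsurj : LinearMap.range L = ⊤ := by
    rw [LinearMap.range_eq_top]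
    intro g
    obtain ⟨f, hf0, hf1, hf2⟩ := cs.exists_split h13 hT hV (fun x => g (Quot.mk _ x))
      (fun x => by rw [cs.quot_mk_simple_smul (by simp)])
    refine ⟨(Quot.lift f ?_, Quot.lift (fun x => g (Quot.mk _ x) - f x) ?_), ?_⟩
    · rintro x _ ⟨k, rfl | rfl, rfl⟩
      · exact (hf0 x).symm
      · exact (hf1 x).symm
    · rintro x _ ⟨k, rfl | rfl, rfl⟩
      · have := hf2 x
        linear_combination this
      · rw [hf1, cs.quot_mk_simple_smul (by simp)]
    · ext q
      obtain ⟨x, rfl⟩ := Quot.exists_rep q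
      rw [hL]
      ring
  have hker : 1 ≤ Module.finrank ℚ (LinearMap.ker L) := by
    rw [Nat.one_le_iff_ne_zero, Ne, Submodule.finrank_eq_zero]
    intro h
    have hmem : ((fun _ => 1, fun _ => -1) : (P → ℚ) × (R → ℚ)) ∈ LinearMap.ker L := by
      rw [LinearMap.mem_ker]
      ext q
      obtain ⟨x, rfl⟩ := Quot.exists_rep q
      rw [hL]
      simp
    rw [h, Submodule.mem_bot, Prod.mk_eq_zero] at hmem
    exact one_ne_zero (congrFun hmem.1 (Quot.mk _ ((1 : W) : W ⧸ V)))
  have := L.finrank_range_add_finrank_ker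
  rw [hsurj, finrank_top, Module.finrank_prod, Module.finrank_fintype_fun_eq_card,
    Module.finrank_fintype_fun_eq_card, Module.finrank_fintype_fun_eq_card] at this
  rw [Nat.card_eq_fintype_card, Nat.card_eq_fintype_card, Nat.card_eq_fintype_card]
  change Fintype.card Q + 1 ≤ Fintype.card P + Fintype.card R
  omega

end RankThree

theorem eq_top_of_forall_simple_smul_eq {B W : Type*} {M : CoxeterMatrix B} [Group W]
    (cs : CoxeterSystem M W) {V : Subgroup W} {x : W ⧸ V} (hx : ∀ i, cs.simple i • x = x) :
    V = ⊤ := by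
  have hall : ∀ w : W, w • x = x := by
    intro w
    induction w using cs.simple_induction with
    | simple i => exact hx i
    | one => exact one_smul _ _
    | mul w w' h h' => rw [mul_smul, h', h]
  rw [eq_top_iff]
  intro w _
  induction x using QuotientGroup.induction_on with
  | H u =>
    have := hall (u * w * u⁻¹)
    rw [MulAction.Quotient.smul_coe, smul_eq_mul, eq_comm, QuotientGroup.eq] at this
    simpa [mul_assoc] using this

end CoxeterSystem

/-- The three simple reflections `s₁, s₂, s₃` are indexed by `0, 1, 2 : Fin 3`; in a `CoxeterMatrix`
an infinite label is encoded by `0`, so the hypotheses say that `m₁₃ = ∞` and that `m₁₂ * m₂₃` is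
divisible neither by `2` nor by `3` (in particular `m₁₂` and `m₂₃` are finite). -/
theorem lemma5p11 {W : Type*} [Group W] (M : CoxeterMatrix (Fin 3)) (cs : CoxeterSystem M W)
    (h13 : M 0 2 = 0) (h2 : ¬ 2 ∣ M 0 1 * M 1 2) (h3 : ¬ 3 ∣ M 0 1 * M 1 2) :
    ¬ ∃ V : Subgroup W, cs.IsReflectionSubgroup V ∧ V.FiniteIndex := by
  classical
  rintro ⟨V, ⟨hne, T, hT, hV⟩, hfin⟩
  have := Fintype.ofFinite (W ⧸ V)
  have h12 : (M 0 1 * M 1 2).Coprime 12 := by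
    have e2 := (Nat.coprime_comm.1 ((Nat.Prime.coprime_iff_not_dvd Nat.prime_two).2 h2))
    have e3 := (Nat.coprime_comm.1 ((Nat.Prime.coprime_iff_not_dvd Nat.prime_three).2 h3))
    exact (e2.mul_right e2).mul_right e3
  have hp : (M 0 1).Coprime 12 := Nat.Coprime.coprime_mul_right h12
  have hq : (M 2 1).Coprime 12 := by
    rw [M.symmetric]
    exact Nat.Coprime.coprime_mul_left h12
  have hleaf0 := cs.simple_smul_eq_self_of_simple_smul_eq hT hV (i := 0) (j := 1) (by decide) (by
    intro k h0 h1
    fin_cases k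
    · exact absurd rfl h0
    · exact absurd rfl h1
    · exact h13)
  have hleaf2 := cs.simple_smul_eq_self_of_simple_smul_eq hT hV (i := 2) (j := 1) (by decide) (by
    intro k h0 h1
    fin_cases k
    · exact (M.symmetric _ _).trans h13
    · exact absurd rfl h1
    · exact absurd rfl h0)
  have k0 := cs.four_mul_card_quot_le hp hleaf0
  have k2 := cs.four_mul_card_quot_le hq hleaf2
  have k1 := cs.card_add_card_fixed_le (X := W ⧸ V) 1
  have k := cs.card_quot_add_one_le h13 hT hV
  have hsplit := Finset.card_filter_add_card_filter_not (s := (Finset.univ : Finset (W ⧸ V)))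
    (fun x => cs.simple 1 • x = x)
  rw [Finset.card_univ] at hsplit
  have hdisj : Disjoint
      (Finset.univ.filter fun x : W ⧸ V => cs.simple 0 • x = x ∧ cs.simple 1 • x = x)
      (Finset.univ.filter fun x : W ⧸ V => cs.simple 2 • x = x ∧ cs.simple 1 • x = x) := by
    rw [Finset.disjoint_left]
    intro x hx hx'
    simp only [Finset.mem_filter, Finset.mem_univ, true_and] at hx hx'
    refine hne (cs.eq_top_of_forall_simple_smul_eq (x := x) fun i => ?_)
    fin_cases i
    · exact hx.1
    · exact hx.2
    · exact hx'.1
  have hle := Finset.card_le_card (Finset.union_subset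
    (Finset.monotone_filter_right (Finset.univ : Finset (W ⧸ V))
      fun x _ (h : cs.simple 0 • x = x ∧ cs.simple 1 • x = x) => h.2)
    (Finset.monotone_filter_right (Finset.univ : Finset (W ⧸ V))
      fun x _ (h : cs.simple 2 • x = x ∧ cs.simple 1 • x = x) => h.2))
  rw [Finset.card_union_of_disjoint hdisj] at hle
  simp only [ne_eq] at k0 k2
  omega
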